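/- Let $R$ be a commutative ring with identity; all modules are unital $R$-modules. Definitions. A finitely generated ideal $J$ of $R$ is a GV-ideal if the natural map $R\to \mathrm{Hom}_R(J,R)$, $r\mapsto (a\mapsto ra)$, is an isomorphism. A module $M$ is GV-torsion-free if no nonzero $x\in M$ satisfies $Jx=0$ for some GV-ideal $J$; it is a $w$-module if moreover $\mathrm{Ext}^1_R(R/J,M)=0$ for every GV-ideal $J$. A $w$-ideal is an ideal of $R$ that is a $w$-module, and a maximal $w$-ideal is a maximal element of the set of proper $w$-ideals (maximal $w$-ideals are prime). $R$ is a DW-ring if every ideal of $R$ is a $w$-ideal. A sequence $0\to A\to B\to C\to 0$ of modules is $w$-exact if $0\to A_{\mathfrak p}\to B_{\mathfrak p}\to C_{\mathfrak p}\to 0$ is exact for every maximal $w$-ideal $\mathfrak p$; it is $w$-pure exact if it is $w$-exact and, for every module $M$, the sequence $0\to A\otimes_R M\to B\otimes_R M\to C\otimes_R M\to 0$ is $w$-exact. A module $A$ is absolutely $w$-pure if for every module $B$ containing $A$ as a submodule the sequence $0\to A\to B\to B/A\to 0$ is $w$-pure exact. A module $M$ is $w$-FP-projective if $\mathrm{Ext}^1_R(M,A)=0$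 for every absolutely $w$-pure module $A$. The $w$-FP-projective dimension $w\text{-}\mathrm{fpd}_R(M)\in\mathbb N\cup\{\infty\}$ is the least integer $n\ge 0$ such that $\mathrm{Ext}^{n+1}_R(M,A)=0$ for every absolutely $w$-pure module $A$ ($\infty$ if there is no such $n$), and $w\text{-}\mathrm{fpD}(R)=\sup\{w\text{-}\mathrm{fpd}_R(M) : M \text{ a finitely generated } R\text{-module}\}$. Proposition. The following are equivalent: (1) $w\text{-}\mathrm{fpD}(R)=0$; (2) every $R$-module is $w$-FP-projective; (3) $R/I$ is $w$-FP-projective for every ideal $I$ of $R$; (4) every absolutely $w$-pure $R$-module is injective; (5) $R$ is a Noetherian DW-ring. -/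

import Mathlib

universe u v w x

open CategoryTheory TensorProduct

noncomputable section

namespace WFP

variable (R : Type u) [CommRing R]

/-- The natural homomorphism `R → J* = Hom_R(J, R)`, sending `r` to multiplication by `r` on `J`. -/
def toDual {R : Type u} [CommRing R] (J : Ideal R) : R →ₗ[R] (J →ₗ[R] R) :=
  LinearMap.toSpanSingleton R (J →ₗ[R] R) (Submodule.subtype J)

/-- Glaz–Vasconcelos ideals. -/
def IsGV {R : Type u} [CommRing R] (J : Ideal R) : Prop :=
  J.FG ∧ Function.Bijective (toDual J)

/-- The element `x` is killed by some GV-ideal, i.e. `x ∈ tor_GV(M)`. -/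
def IsGVTorsionElement {M : Type v} [AddCommGroup M] [Module R M] (x : M) : Prop :=
  ∃ J : Ideal R, IsGV J ∧ ∀ a ∈ J, a • x = 0

/-- `tor_GV(M) = 0`. -/
def IsGVTorsionFree (M : Type v) [AddCommGroup M] [Module R M] : Prop :=
  ∀ x : M, IsGVTorsionElement R x → x = 0

/-- `Ext_R^n(M, N) = 0`. -/
def ExtVanishes (n : ℕ) (M N : Type u) [AddCommGroup M] [Module R M]
    [AddCommGroup N] [Module R N] : Prop :=
  Subsingleton (Abelian.Ext (ModuleCat.of R M) (ModuleCat.of R N) n)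

/-- `w`-modules: GV-torsion-free modules `M` with `Ext_R^1(R/J, M) = 0` for all GV-ideals `J`. -/
def IsWModule (M : Type u) [AddCommGroup M] [Module R M] : Prop :=
  IsGVTorsionFree R M ∧ ∀ J : Ideal R, IsGV J → ExtVanishes R 1 (R ⧸ J) M

/-- `w`-ideals: ideals that are `w`-modules. -/
def IsWIdeal {R : Type u} [CommRing R] (I : Ideal R) : Prop := IsWModule R I

/-- Maximal `w`-ideals: maximal elements among the proper `w`-ideals. -/
def IsMaximalWIdeal {R : Type u} [CommRing R] (p : Ideal R) : Prop :=
  Maximal (fun I : Ideal R => IsWIdeal I ∧ I ≠ ⊤) p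

/-- DW-rings: every ideal is a `w`-ideal. -/
def IsDWRing : Prop := ∀ I : Ideal R, IsWIdeal I

section Exactness

variable {A : Type v} {B : Type w} {C : Type x} [AddCommGroup A] [AddCommGroup B] [AddCommGroup C]
  [Module R A] [Module R B] [Module R C]

/-- `0 → A → B → C → 0` is `w`-exact: it becomes exact after localization at every maximal
`w`-ideal `p`. Maximal `w`-ideals are always prime, so the instance argument `p.IsPrime`,
needed to form the localization, excludes no `p`. -/
def IsWExact (f : A →ₗ[R] B) (g : B →ₗ[R] C) : Prop :=
  ∀ (p : Ideal R) [p.IsPrime], IsMaximalWIdeal p →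
    Function.Injective (LocalizedModule.map p.primeCompl f) ∧
    Function.Exact (LocalizedModule.map p.primeCompl f) (LocalizedModule.map p.primeCompl g) ∧
    Function.Surjective (LocalizedModule.map p.primeCompl g)

/-- `0 → A → B → C → 0` is `w`-pure exact: it is `w`-exact, and stays so after tensoring with
any `R`-module. -/
def IsWPureExact (f : A →ₗ[R] B) (g : B →ₗ[R] C) : Prop :=
  IsWExact R f g ∧
    ∀ (M : Type u) [AddCommGroup M] [Module R M], IsWExact R (f.rTensor M) (g.rTensor M)

end Exactness

/-- `w`-pure submodules. -/
def IsWPureSubmodule {B : Type v} [AddCommGroup B] [Module R B] (A : Submodule R B) : Prop :=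
  IsWPureExact R A.subtype A.mkQ

/-- Absolutely `w`-pure modules: `w`-pure in every module that contains them. -/
def IsAbsolutelyWPure (A : Type u) [AddCommGroup A] [Module R A] : Prop :=
  ∀ (B : Type u) [AddCommGroup B] [Module R B] (i : A →ₗ[R] B),
    Function.Injective i → IsWPureSubmodule R (LinearMap.range i)

/-- `w`-FP-projective modules. -/
def IsWFPProjective (M : Type u) [AddCommGroup M] [Module R M] : Prop :=
  ∀ (A : Type u) [AddCommGroup A] [Module R A], IsAbsolutelyWPure R A → ExtVanishes R 1 M A

/-- The `w`-FP-projective dimension of a module: the smallest `n` such that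
`Ext_R^{n+1}(M, A) = 0` for all absolutely `w`-pure `A`, and `⊤` if there is none. -/
def wfpd (M : Type u) [AddCommGroup M] [Module R M] : ℕ∞ :=
  ⨅ (n : ℕ) (_ : ∀ (A : Type u) [AddCommGroup A] [Module R A],
    IsAbsolutelyWPure R A → ExtVanishes R (n + 1) M A), (n : ℕ∞)

/-- The `w`-FP-projective dimension of a ring: the supremum of the dimensions of its finitely
generated modules. -/
def wfpD : ℕ∞ :=
  ⨆ (M : ModuleCat.{u} R) (_ : Module.Finite R M), wfpd R M

end WFP

end

namespace WFP

open Function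

/-! ### Extension of maps and Baer's criterion in terms of Ext. -/

section Ext

variable {R : Type u} [CommRing R]

/-! By Baer's criterion `A` is injective once every `Ext^1(R/I, A)` vanishes; this makes (1)–(4)
formally equivalent, and the content is (4) ⇔ (5).

For (4) ⇒ (5), two kinds of absolutely `w`-pure modules are tested. Direct sums of injectives
(`isAbsolutelyWPure_directSum`) give Noetherianity by Bass's argument. Modules killed by a GV-ideal
`J` vanish at all maximal `w`-ideals; so if `J` lies in a maximal ideal `m`, then `R/m` is
injective, which forces some `s ∉ m` to kill `J`, against injectivity of `R → J*`. Hence `R` is the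
only GV-ideal and `R` is DW.

For (5) ⇒ (4), maximal ideals of a DW-ring are maximal `w`-ideals, so `w`-pure means pure. A pure
submodule of an injective module satisfies Baer's criterion for finitely generated ideals, that is,
for all ideals. -/

theorem extVanishes_of_injective (M A : Type u) [AddCommGroup M] [Module R M] [AddCommGroup A]
    [Module R A] (h : Module.Injective R A) (n : ℕ) : ExtVanishes R (n + 1) M A :=
  have := Module.injective_object_of_injective_module (R := R) (M := A)
  Abelian.Ext.subsingleton_of_injective _ _ n

theorem extVanishes_of_subsingleton (M A : Type u) [AddCommGroup M] [Module R M] [AddCommGroup A]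
    [Module R A] [Subsingleton M] (n : ℕ) : ExtVanishes R n M A := by
  have hz : Limits.IsZero (ModuleCat.of R M) := ModuleCat.isZero_of_subsingleton _
  refine subsingleton_of_forall_eq 0 fun e ↦ ?_
  rw [← Abelian.Ext.mk₀_id_comp e, hz.eq_of_src (𝟙 _) 0, Abelian.Ext.mk₀_zero,
    Abelian.Ext.zero_comp]

/-- The obstruction to extending `f` to `R` is its image under the connecting map to `Ext^1(R/I,
A)`. -/
theorem exists_extension_of_extVanishes {I : Ideal R} {A : Type u} [AddCommGroup A] [Module R A]
    (h : ExtVanishes R 1 (R ⧸ I) A) (f : I →ₗ[R] A) :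
    ∃ g : R →ₗ[R] A, ∀ x : I, g x = f x := by
  let S : ShortComplex (ModuleCat.{u} R) :=
    ShortComplex.moduleCatMk (Submodule.subtype I) (Submodule.mkQ I) 
      (LinearMap.ext fun x ↦ (Submodule.Quotient.mk_eq_zero I).2 x.2)
  have hS : S.ShortExact :=
    { exact := by
        rw [ShortComplex.moduleCat_exact_iff]
        intro x hx
        exact ⟨⟨x, (Submodule.Quotient.mk_eq_zero I).1 hx⟩, rfl⟩
      mono_f := (ModuleCat.mono_iff_injective _).2 Subtype.val_injective
      epi_g := (ModuleCat.epi_iff_surjective _).2 (Submodule.mkQ_surjective I) }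
  have hsub : Subsingleton (Abelian.Ext S.X₃ (ModuleCat.of R A) 1) := h
  obtain ⟨e, he⟩ := Abelian.Ext.contravariant_sequence_exact₁ hS (ModuleCat.of R A)
    (Abelian.Ext.mk₀ (ModuleCat.ofHom f)) (n₁ := 1) rfl (Subsingleton.elim _ _)
  obtain ⟨g, rfl⟩ := Abelian.Ext.addEquiv₀.symm.surjective e
  rw [Abelian.Ext.addEquiv₀_symm_apply, Abelian.Ext.mk₀_comp_mk₀] at he
  have hg := (Abelian.Ext.mk₀_bijective _ _).1 he
  exact ⟨g.hom, fun x ↦ congr($(hg).hom x)⟩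

theorem injective_of_forall_extVanishes {A : Type u} [AddCommGroup A] [Module R A]
    (h : ∀ I : Ideal R, ExtVanishes R 1 (R ⧸ I) A) : Module.Injective R A :=
  Module.Baer.injective fun I f ↦
    (exists_extension_of_extVanishes (h I) f).imp fun _ hg x hx ↦ hg ⟨x, hx⟩

end Ext

theorem exists_injective_embedding (R : Type u) [CommRing R] (M : Type u) [AddCommGroup M]
    [Module R M] : ∃ (E : ModuleCat.{u} R) (i : M →ₗ[R] E),
      Module.Injective R E ∧ Injective i := by
  obtain ⟨P⟩ := EnoughInjectives.presentation (ModuleCat.of R M)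
  have := P.injective
  have := P.mono
  exact ⟨P.J, P.f.hom, Module.injective_module_of_injective_object R P.J,
    (ModuleCat.mono_iff_injective _).1 inferInstance⟩

section Dimension

variable (R : Type u) [CommRing R]

theorem wfpd_eq_zero_iff (M : Type u) [AddCommGroup M] [Module R M] :
    wfpd R M = 0 ↔ IsWFPProjective R M := by
  constructor
  · intro h
    by_contra hM
    have : (1 : ℕ∞) ≤ wfpd R M := by
      refine le_iInf₂ fun n hn ↦ ?_
      rcases n with _ | n
      · exact (hM hn).elim
      · exact_mod_cast Nat.succ_le_succ n.zero_le
    simp [h] at this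
  · intro h
    exact le_antisymm (iInf₂_le 0 h) bot_le

theorem wfpD_eq_zero_iff : wfpD R = 0 ↔
    ∀ M : ModuleCat.{u} R, Module.Finite R M → IsWFPProjective R M := by
  simp only [wfpD, ← wfpd_eq_zero_iff]
  exact iSup₂_eq_bot

end Dimension

/-! ### Two sources of absolutely `w`-pure modules. -/

section Localization

variable {R : Type u} [CommRing R]

theorem isWExact_of_exact {A : Type v} {B : Type w} {C : Type x} [AddCommGroup A]
    [AddCommGroup B] [AddCommGroup C] [Module R A] [Module R B] [Module R C]
    {f : A →ₗ[R] B} {g : B →ₗ[R] C} (hfg : Exact f g) (hg : Surjective g)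
    (hf : ∀ (p : Ideal R) [p.IsPrime], IsMaximalWIdeal p →
      Injective (LocalizedModule.map p.primeCompl f)) : IsWExact R f g :=
  fun p _ hp ↦ ⟨hf p hp, LocalizedModule.map_exact p.primeCompl f g hfg,
    LocalizedModule.map_surjective p.primeCompl g hg⟩

/-- Tensoring is right exact and localization is exact, so only injectivity on the left can fail. -/
theorem isAbsolutelyWPure_of_rTensor {A : Type u} [AddCommGroup A] [Module R A]
    (h : ∀ (B : Type u) [AddCommGroup B] [Module R B] (i : A →ₗ[R] B), Injective i →
      ∀ (M : Type u) [AddCommGroup M] [Module R M] (p : Ideal R) [p.IsPrime],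
        IsMaximalWIdeal p → Injective (LocalizedModule.map p.primeCompl (i.rTensor M))) :
    IsAbsolutelyWPure R A := by
  intro B _ _ i hi
  have hex := LinearMap.exact_subtype_mkQ (LinearMap.range i)
  have hsurj := (LinearMap.range i).mkQ_surjective
  refine ⟨isWExact_of_exact hex hsurj fun p _ _ ↦
    LocalizedModule.map_injective p.primeCompl _ (Submodule.subtype_injective _),
    fun M _ _ ↦ isWExact_of_exact (rTensor_exact M hex hsurj)
      (LinearMap.rTensor_surjective M hsurj) fun p _ hp ↦ ?_⟩
  let e := LinearEquiv.ofInjective i hi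
  have he : i.rTensor M = (LinearMap.range i).subtype.rTensor M ∘ₗ (e.rTensor M).toLinearMap := by
    rw [LinearEquiv.coe_rTensor, ← LinearMap.rTensor_comp]; rfl
  have hinj := h B i hi M p hp
  intro x y hxy
  obtain ⟨x, rfl⟩ := LocalizedModule.map_surjective p.primeCompl _ (e.rTensor M).surjective x
  obtain ⟨y, rfl⟩ := LocalizedModule.map_surjective p.primeCompl _ (e.rTensor M).surjective y
  congr 1
  apply hinj
  rw [he]
  induction x using LocalizedModule.induction_on with | _ a s
  induction y using LocalizedModule.induction_on with | _ b t
  simp only [LocalizedModule.map_mk] at hxy ⊢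
  exact hxy

theorem IsGV.not_le_of_isMaximalWIdeal {J p : Ideal R} (hJ : IsGV J) (hp : IsMaximalWIdeal p) :
    ¬ J ≤ p := by
  intro hJp
  -- The inclusion of `J` in `p` extends to `R`, so on `J` it is multiplication by `g 1`;
  -- faithfulness gives `g 1 = 1`, an element of `p`.
  obtain ⟨g, hg⟩ := exists_extension_of_extVanishes (hp.1.1.2 J hJ) (Submodule.inclusion hJp)
  have h1 : toDual J (g 1 : R) = toDual J 1 := by
    ext x
    have := congrArg (Subtype.val) (hg x)
    rw [← mul_one (x : R), ← smul_eq_mul, map_smul] at this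
    simpa [toDual, mul_comm] using this
  have h2 : (g 1 : R) = 1 := hJ.2.1 h1
  exact hp.1.2 ((Ideal.eq_top_iff_one p).2 (h2 ▸ (g 1).2))

theorem IsGV.isAbsolutelyWPure_of_smul_eq_zero {J : Ideal R} (hJ : IsGV J) {A : Type u}
    [AddCommGroup A] [Module R A] (hA : ∀ r ∈ J, ∀ x : A, r • x = 0) :
    IsAbsolutelyWPure R A := by
  refine isAbsolutelyWPure_of_rTensor fun B _ _ i _ M _ _ p _ hp ↦ ?_
  obtain ⟨r, hrJ, hrp⟩ := Set.not_subset.1 (hJ.not_le_of_isMaximalWIdeal hp)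
  have : Subsingleton (LocalizedModule p.primeCompl (A ⊗[R] M)) := by
    refine LocalizedModule.subsingleton_iff.2 fun z ↦ ⟨r, hrp, ?_⟩
    induction z with
    | zero => exact smul_zero _
    | tmul a m => rw [TensorProduct.smul_tmul', hA r hrJ, TensorProduct.zero_tmul]
    | add a b ha hb => rw [smul_add, ha, hb, add_zero]
  exact injective_of_subsingleton _

/-- Each projection to `E n` extends over `B`, so an element killed in `B ⊗ M` has zero image in
every `E n ⊗ M`. -/
theorem isAbsolutelyWPure_directSum {ι : Type u} [DecidableEq ι] (E : ι → Type u)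
    [∀ n, AddCommGroup (E n)] [∀ n, Module R (E n)] (hE : ∀ n, Module.Injective R (E n)) :
    IsAbsolutelyWPure R (DirectSum ι E) := by
  refine isAbsolutelyWPure_of_rTensor fun B _ _ i hi M _ _ p _ hp ↦
    LocalizedModule.map_injective p.primeCompl _ ?_
  rw [injective_iff_map_eq_zero]
  intro z hz
  apply (TensorProduct.directSumLeft R R E M).injective
  rw [map_zero]
  ext n
  obtain ⟨r, hr⟩ := (hE n).out i hi (DirectSum.component R ι E n)
  have hcomp : ∀ z, TensorProduct.directSumLeft R R E M z n =
      (DirectSum.component R ι E n).rTensor M z := by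
    intro z
    induction z with
    | zero => simp
    | tmul a m => simp [TensorProduct.directSumLeft_tmul, DirectSum.apply_eq_component R a]
    | add a b ha hb => rw [map_add, map_add, DirectSum.add_apply, ha, hb]
  have hri : r ∘ₗ i = DirectSum.component R ι E n := LinearMap.ext hr
  rw [hcomp, ← hri, LinearMap.rTensor_comp_apply, hz, map_zero, DirectSum.zero_apply]

end Localization

/-! ### Consequences of injectivity: Noetherian and DW. -/

section Injective

variable {R : Type u} [CommRing R]

/-- Each `R/c n` embeds in an injective `E n`. On the union `I` of the chain, the map to the product
lands in the direct sum and extends to `R`; the finite support of the image of `1` bounds where the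
chain stops. -/
theorem isNoetherianRing_of_injective_directSum
    (h : ∀ E : ULift.{u} ℕ → ModuleCat.{u} R, (∀ n, Module.Injective R (E n)) →
      Module.Injective R (DirectSum (ULift.{u} ℕ) fun n ↦ E n)) : IsNoetherianRing R := by
  rw [isNoetherianRing_iff, ← monotone_stabilizes_iff_noetherian]
  intro c
  choose E i hE hi using fun n : ULift.{u} ℕ ↦ exists_injective_embedding R (R ⧸ c n.down)
  let F : R →ₗ[R] ∀ n, E n := LinearMap.pi fun n ↦ i n ∘ₗ Submodule.mkQ (c n.down)
  have hF : ∀ r n, F r n = 0 ↔ r ∈ c n.down := fun r n ↦ by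
    rw [← Submodule.Quotient.mk_eq_zero (c n.down)]
    exact map_eq_zero_iff _ (hi n)
  let I : Ideal R := ⨆ n, c n
  have hI : ∀ r, r ∈ I ↔ ∃ n, r ∈ c n := fun r ↦
    Submodule.mem_iSup_of_directed _ c.monotone.directed_le
  let U : DirectSum (ULift.{u} ℕ) (fun n ↦ E n) →ₗ[R] ∀ n, E n := DFinsupp.coeFnLinearMap R
  have hU : Injective U := DFunLike.coe_injective
  have hFU : ∀ r : I, (F ∘ₗ I.subtype) r ∈ LinearMap.range U := by
    rintro ⟨r, hr⟩
    obtain ⟨k, hk⟩ := (hI r).1 hr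
    have hfin : {n | F r n ≠ 0}.Finite := by
      refine ((Set.finite_Iio k).preimage ULift.down_injective.injOn).subset fun n hn ↦ ?_
      by_contra hkn
      exact hn ((hF r n).2 (c.monotone (not_lt.1 hkn) hk))
    classical
    refine ⟨DFinsupp.mk (β := fun n ↦ E n) hfin.toFinset fun n ↦ F r n, funext fun n ↦ ?_⟩
    change (DFinsupp.mk (β := fun n ↦ E n) hfin.toFinset fun n ↦ F r n) n = F r n
    rw [DFinsupp.mk_apply]
    split_ifs with hn
    · rfl
    · simpa using Eq.symm (by simpa using hn)
  let G : I →ₗ[R] DirectSum (ULift.{u} ℕ) (fun n ↦ E n) :=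
    (LinearEquiv.ofInjective U hU).symm ∘ₗ (F ∘ₗ I.subtype).codRestrict (LinearMap.range U) hFU
  have hG : ∀ (r : I) n, G r n = F r n := fun r n ↦ by
    have := LinearEquiv.apply_symm_apply (LinearEquiv.ofInjective U hU)
      ((F ∘ₗ I.subtype).codRestrict (LinearMap.range U) hFU r)
    exact congr_fun (congrArg Subtype.val this) n
  obtain ⟨g, hg⟩ := (h E hE).out (Submodule.subtype I) Subtype.val_injective G
  classical
  obtain ⟨k, hk⟩ : ∃ k : ℕ, ∀ n, k ≤ n → g 1 (ULift.up n) = 0 := by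
    obtain ⟨k, hk⟩ := ((g 1).support.image ULift.down).exists_nat_subset_range
    refine ⟨k, fun n hn ↦ ?_⟩
    by_contra hne
    have : n ∈ (g 1).support.image ULift.down :=
      Finset.mem_image.2 ⟨ULift.up n, DFinsupp.mem_support_iff.2 hne, rfl⟩
    exact absurd (Finset.mem_range.1 (hk this)) (not_lt.2 hn)
  have hle : ∀ n, k ≤ n → I ≤ c n := by
    intro n hn r hr
    have h1 := hg ⟨r, hr⟩
    have h2 : g r = r • g 1 := by rw [← map_smul, smul_eq_mul, mul_one]
    refine (hF r (ULift.up n)).1 ?_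
    rw [← hG ⟨r, hr⟩, ← h1]
    change g r (ULift.up n) = 0
    rw [h2, DirectSum.smul_apply, hk n hn, smul_zero]
  exact ⟨k, fun m hm ↦ le_antisymm (c.monotone hm) ((le_iSup (fun n ↦ c n) m).trans (hle k le_rfl))⟩

/-- Otherwise `a ↦ 1` defines a map `Ra → R/m`. Extended to `R`, it gives `1 = a • g 1`, which is
zero since `a ∈ m`. -/
theorem exists_notMem_mul_eq_zero_of_injective {m : Ideal R} (hm : m.IsMaximal)
    (h : Module.Injective R (R ⧸ m)) {a : R} (ha : a ∈ m) : ∃ s ∉ m, s * a = 0 := by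
  by_contra! hs
  have hker : LinearMap.ker (LinearMap.toSpanSingleton R R a) ≤
      LinearMap.ker (Submodule.mkQ m) := by
    intro s hsa
    rw [Submodule.ker_mkQ]
    by_contra hsm
    exact hs s hsm (by simpa using hsa)
  let T := LinearMap.toSpanSingleton R R a
  let φ : (R ⧸ LinearMap.ker T) →ₗ[R] R ⧸ m := (LinearMap.ker T).liftQ (Submodule.mkQ m) hker
  let ψ : (R ⧸ LinearMap.ker T) →ₗ[R] R := (LinearMap.ker T).liftQ T le_rfl
  have hψ : Injective ψ := LinearMap.ker_eq_bot.1 (Submodule.ker_liftQ_eq_bot _ _ _ le_rfl)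
  obtain ⟨g, hg⟩ := h.out ψ hψ φ
  have h1 := hg ((LinearMap.ker T).mkQ 1)
  have h2 : ψ ((LinearMap.ker T).mkQ 1) = a := one_smul R a
  have h3 : φ ((LinearMap.ker T).mkQ 1) = Submodule.mkQ m 1 := rfl
  have h4 : g a = a • g 1 := by rw [← map_smul, smul_eq_mul, mul_one]
  obtain ⟨c, hc⟩ := Submodule.mkQ_surjective m (g 1)
  rw [h2, h3, h4, ← hc, ← map_smul, smul_eq_mul] at h1
  have h5 : a * c - 1 ∈ m := (Submodule.Quotient.eq m).1 h1
  exact hm.ne_top ((Ideal.eq_top_iff_one m).2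
    ((Submodule.sub_mem_iff_right m (m.mul_mem_right c ha)).1 h5))

theorem exists_notMem_forall_mul_eq_zero {m J : Ideal R} (hm : m.IsPrime) (hJ : J.FG)
    (h : ∀ a ∈ J, ∃ s ∉ m, s * a = 0) : ∃ s ∉ m, ∀ a ∈ J, s * a = 0 := by
  obtain ⟨t, rfl⟩ := hJ
  choose! f hfm hf using fun a (ha : a ∈ t) ↦ h a (Submodule.subset_span ha)
  refine ⟨∏ a ∈ t, f a, fun hmem ↦ ?_, fun a ha ↦ ?_⟩
  · obtain ⟨a, ha, hfa⟩ := (hm.prod_mem_iff).1 hmem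
    exact hfm a ha hfa
  · induction ha using Submodule.span_induction with
    | mem a ha =>
      obtain ⟨c, hc⟩ := Finset.dvd_prod_of_mem f ha
      rw [hc, mul_right_comm, hf a ha, zero_mul]
    | zero => exact mul_zero _
    | add a b _ _ ha hb => rw [mul_add, ha, hb, add_zero]
    | smul r a _ ha => rw [smul_eq_mul, mul_left_comm, ha, mul_zero]

theorem IsGV.eq_top_of_forall_injective
    (h : ∀ (A : Type u) [AddCommGroup A] [Module R A], IsAbsolutelyWPure R A →
      Module.Injective R A) {J : Ideal R} (hJ : IsGV J) : J = ⊤ := by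
  by_contra hne
  obtain ⟨m, hm, hJm⟩ := Ideal.exists_le_maximal J hne
  have hinj : Module.Injective R (R ⧸ m) := h _ <| hJ.isAbsolutelyWPure_of_smul_eq_zero <| by
    rintro r hr ⟨x⟩
    exact (Submodule.Quotient.mk_eq_zero m).2 (m.mul_mem_right x (hJm hr))
  obtain ⟨s, hsm, hs⟩ := exists_notMem_forall_mul_eq_zero hm.isPrime hJ.1
    fun a ha ↦ exists_notMem_mul_eq_zero_of_injective hm hinj (hJm ha)
  have h0 : toDual J s = toDual J 0 := by
    ext x
    simpa [toDual] using hs x x.2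
  exact hsm (hJ.2.1 h0 ▸ m.zero_mem)

theorem isDWRing_of_forall_isGV_eq_top (h : ∀ J : Ideal R, IsGV J → J = ⊤) : IsDWRing R := by
  refine fun I ↦ ⟨fun x ⟨J, hJ, hx⟩ ↦ ?_, fun J hJ ↦ ?_⟩
  · simpa using hx 1 (h J hJ ▸ Submodule.mem_top)
  · have : Subsingleton (R ⧸ J) := Ideal.Quotient.subsingleton_iff.2 (h J hJ)
    exact extVanishes_of_subsingleton _ _ 1

/-! ### Purity over DW-rings and the return to injectivity. -/

theorem IsDWRing.isMaximalWIdeal (h : IsDWRing R) {m : Ideal R} (hm : m.IsMaximal) :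
    IsMaximalWIdeal m :=
  ⟨⟨h m, hm.ne_top⟩, fun _ hI hmI ↦ (hm.eq_of_le hI.2 hmI).ge⟩

theorem IsDWRing.rTensor_injective (h : IsDWRing R) {B : Type v} [AddCommGroup B] [Module R B]
    {A : Submodule R B} (hA : IsWPureSubmodule R A) (M : Type u) [AddCommGroup M] [Module R M] :
    Injective (A.subtype.rTensor M) :=
  injective_of_localized_maximal _ fun J hJ ↦ (hA.2 M J (h.isMaximalWIdeal hJ)).1

/-- A system `s k • x = f k` solvable in `B` is solvable in the pure submodule `A`: tensor with `R^n
/ (s)`, where `∑ f k ⊗ e k` becomes `b ⊗ ∑ s k • e k = 0`. -/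
theorem exists_smul_eq_of_rTensor_injective {B : Type v} [AddCommGroup B] [Module R B]
    {A : Submodule R B}
    (hA : ∀ (M : Type u) [AddCommGroup M] [Module R M], Injective (A.subtype.rTensor M))
    {n : ℕ} (s : Fin n → R) (f : Fin n → A) (b : B) (hb : ∀ k, (f k : B) = s k • b) :
    ∃ a : A, ∀ k, f k = s k • a := by
  let N : Submodule R (Fin n → R) := R ∙ s
  let e : Fin n → (Fin n → R) ⧸ N := fun k ↦ N.mkQ (Pi.single k 1)
  have he : ∀ c : Fin n → R, ∑ k, c k • e k = N.mkQ c := fun c ↦ by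
    simp only [e, ← map_smul, ← map_sum]
    congr 1
    exact (pi_eq_sum_univ' c).symm
  have hspan : Submodule.span R (Set.range e) = ⊤ := by
    refine top_unique fun x _ ↦ ?_
    obtain ⟨c, rfl⟩ := N.mkQ_surjective x
    rw [← he]
    exact Submodule.sum_smul_mem _ _ fun k _ ↦ Submodule.subset_span ⟨k, rfl⟩
  have h0 : ∑ k, f k ⊗ₜ[R] e k = 0 := by
    apply hA
    rw [map_zero, map_sum]
    simp only [LinearMap.rTensor_tmul, Submodule.subtype_apply, hb, TensorProduct.smul_tmul]
    rw [← TensorProduct.tmul_sum, he, Submodule.mkQ_apply,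
      (Submodule.Quotient.mk_eq_zero N).2 (Submodule.mem_span_singleton_self s),
      TensorProduct.tmul_zero]
  have h1 : ∑ k, e k ⊗ₜ[R] f k = 0 := by
    simpa using congrArg (TensorProduct.comm R A _) h0
  -- By the equational criterion, `f k = ∑ c k j • y j` where each column of `c` is a relation among
  -- the `e k`, hence a multiple `d j • s`.
  obtain ⟨l, c, y, hy, hc⟩ := TensorProduct.vanishesTrivially_of_sum_tmul_eq_zero R hspan h1
  have hcs : ∀ j, ∃ d : R, d • s = fun k ↦ c k j := fun j ↦ by
    have := hc j
    rw [he fun k ↦ c k j] at this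
    exact Submodule.mem_span_singleton.1 ((Submodule.Quotient.mk_eq_zero N).1 this)
  choose d hd using hcs
  refine ⟨∑ j, d j • y j, fun k ↦ ?_⟩
  rw [hy k, Finset.smul_sum]
  refine Finset.sum_congr rfl fun j _ ↦ ?_
  rw [← congr_fun (hd j) k, Pi.smul_apply, smul_eq_mul, mul_comm, mul_smul]

theorem IsAbsolutelyWPure.injective (hN : IsNoetherianRing R) (hD : IsDWRing R) {A : Type u}
    [AddCommGroup A] [Module R A] (hA : IsAbsolutelyWPure R A) : Module.Injective R A := by
  obtain ⟨E, i, hE, hi⟩ := exists_injective_embedding R A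
  let e := LinearEquiv.ofInjective i hi
  refine Module.Baer.injective fun I f ↦ ?_
  obtain ⟨g, hg⟩ := hE.out (Submodule.subtype I) Subtype.val_injective (i ∘ₗ f)
  obtain ⟨n, s, hs⟩ := Submodule.fg_iff_exists_fin_generating_family.1 (hN.noetherian I)
  have hsI : ∀ k, s k ∈ I := fun k ↦ hs ▸ Submodule.subset_span ⟨k, rfl⟩
  -- In `E` the system on the generators of `I` is solved by `g 1`; purity moves the solution into
  -- the image of `A`.
  obtain ⟨a, ha⟩ := exists_smul_eq_of_rTensor_injective
    (fun M _ _ ↦ hD.rTensor_injective (hA E i hi) M) s (fun k ↦ e (f ⟨s k, hsI k⟩)) (g 1)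
    fun k ↦ by
      rw [← map_smul, smul_eq_mul, mul_one]
      exact (hg ⟨s k, hsI k⟩).symm
  refine ⟨LinearMap.toSpanSingleton R A (e.symm a), fun x hx ↦ ?_⟩
  -- The locus where the two maps agree is a submodule containing the generators of `I`.
  have hle : I ≤ (LinearMap.ker (LinearMap.toSpanSingleton R A (e.symm a) ∘ₗ I.subtype - f)).map
      I.subtype := by
    conv_lhs => rw [← hs]
    refine Submodule.span_le.2 ?_
    rintro _ ⟨k, rfl⟩
    refine ⟨⟨s k, hsI k⟩, ?_, rfl⟩
    have := congrArg e.symm (ha k)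
    rw [e.symm_apply_apply, map_smul] at this
    simp [this]
  obtain ⟨y, hy, rfl⟩ := hle hx
  exact sub_eq_zero.1 hy

end Injective

end WFP

theorem mainTheorem3 (R : Type u) [CommRing R] :
    [ WFP.wfpD R = 0,
      ∀ (M : Type u) [AddCommGroup M] [Module R M], WFP.IsWFPProjective R M,
      ∀ I : Ideal R, WFP.IsWFPProjective R (R ⧸ I),
      ∀ (A : Type u) [AddCommGroup A] [Module R A],
        WFP.IsAbsolutelyWPure R A → Module.Injective R A,
      IsNoetherianRing R ∧ WFP.IsDWRing R ].TFAE := by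
  tfae_have 2 → 1 := fun h ↦ (WFP.wfpD_eq_zero_iff R).2 fun M _ ↦ h M
  tfae_have 1 → 3 := fun h I ↦
    (WFP.wfpD_eq_zero_iff R).1 h (ModuleCat.of R (R ⧸ I)) (inferInstanceAs (Module.Finite R (R ⧸ I)))
  tfae_have 3 → 4 := fun h A _ _ hA ↦
    WFP.injective_of_forall_extVanishes fun I ↦ h I A hA
  tfae_have 4 → 2 := fun h M _ _ A _ _ hA ↦ WFP.extVanishes_of_injective M A (h A hA) 0
  tfae_have 4 → 5 := fun h ↦
    ⟨WFP.isNoetherianRing_of_injective_directSum fun _ hE ↦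
      h _ (WFP.isAbsolutelyWPure_directSum _ hE),
      WFP.isDWRing_of_forall_isGV_eq_top fun _ hJ ↦ hJ.eq_top_of_forall_injective h⟩
  tfae_have 5 → 4 := fun ⟨hN, hD⟩ _ _ _ hA ↦ hA.injective hN hD
  tfae_finish
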